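/- Notation. Let $x>0$, $y\ge 2$, $u=\frac{\log x}{\log y}$. Let $\mathcal S_y$ be the set of natural numbers $n \ge 1$ all of whose prime factors are at most $y$, and put $$\Psi(x,y)=|\mathcal S_y\cap[1,x]|,\qquad \Phi(x,y)=|\{1\le n\le x:\ p\mid n\Rightarrow p>y\}|,\qquad \Pi(y)=\prod_{p\le y}\left(1-\frac1p\right),$$ where $p$ denotes primes. Let $\rho$ be Dickman's function ($\rho$ is continuous on $[0,\infty)$, $\rho(u)=1$ for $0\le u\le 1$, $u\rho'(u)=-\rho(u-1)$ for $u>1$), with $\rho'$ defined by right-continuity at $0$ and $1$, and let $\omega$ be Buchstab's function ($\omega(u)=0$ for $u<1$, $u\,\omega(u)=1$ for $1\le u\le 2$, $(u\,\omega(u))'=\omega(u-1)$ for $u>2$, $\omega$ continuous on $[1,\infty)$). Let $\{x\}$ be the fractional part of $x$, $\gamma$ Euler's constant, and $\mu_y(u)=\int_0^u\omega(u-v)y^{-v}\,dv$. For $x \ge 1$ define $$\Lambda(x,y)=x\rho(u)-\{x\}-x\int_0^u\rho'(u-v)\frac{\{y^v\}}{y^v}\,dv,\qquad \Delta(x,y)=\Psi(x,y)-\Lambda(x,y),$$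 and for $x>0$ define $$Q(x,y)=1_{x\ge1}+x\left(\Pi(y)-\frac{e^{-\gamma}}{\log y}+\mu_y(u)\right)-\Phi(x,y),\qquad Q^*(x,y)=1_{x\ge1}+x\mu_y(u)-\Phi(x,y),$$ $$R(x,y)=\sum_{n\in\mathcal S_y}Q(x/n,y),\qquad R^*(x,y)=\sum_{n\in\mathcal S_y}Q^*(x/n,y).$$ Corollary. Let $X\ge1$, $y\ge2$ and $f(y)>0$. If $$|Q(x,y)|\le x f(y)\qquad(1\le x\le X),$$ then the series defining $R(x,y)$ converges absolutely for $0<x\le X$, $$|R(x,y)|\le x f(y)\,\Pi(y)^{-1}\qquad(0<x\le X),$$ and $$|\Delta(x,y)|\le 2x f(y)\,\Pi(y)^{-1}\qquad(1\le x\le X).$$ The same holds if $(Q,R)$ is replaced by $(Q^*,R^*)$. -/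

import Mathlib

noncomputable section

namespace SmoothRough

/-- The set `S_y` of `y`-smooth natural numbers: positive integers all of whose prime factors are
at most `y`. -/
def smoothSet (y : ℝ) : Set ℕ :=
  {n | 1 ≤ n ∧ ∀ p : ℕ, p.Prime → p ∣ n → (p : ℝ) ≤ y}

/-- The set of `y`-rough natural numbers: positive integers all of whose prime factors exceed
`y`. -/
def roughSet (y : ℝ) : Set ℕ :=
  {n | 1 ≤ n ∧ ∀ p : ℕ, p.Prime → p ∣ n → y < (p : ℝ)}

/-- `Ψ(x, y)`, the number of `y`-smooth positive integers up to `x`. -/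
def Psi (x y : ℝ) : ℝ := ({n : ℕ | n ∈ smoothSet y ∧ (n : ℝ) ≤ x}.ncard : ℝ)

/-- `Φ(x, y)`, the number of `y`-rough positive integers up to `x`. -/
def Phi (x y : ℝ) : ℝ := ({n : ℕ | n ∈ roughSet y ∧ (n : ℝ) ≤ x}.ncard : ℝ)

/-- Iterates of the integral equation of Dickman's function: `dickmanIter n` agrees with `ρ` on
`(-∞, n + 1]`. -/
def dickmanIter : ℕ → ℝ → ℝ
  | 0 => fun u => if u < 0 then 0 else 1
  | n + 1 => fun u =>
      if u < 0 then 0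
      else if u ≤ 1 then 1
      else 1 - ∫ t in (1 : ℝ)..u, dickmanIter n (t - 1) / t

/-- Dickman's function `ρ`: the continuous function on `[0, ∞)` with `ρ(u) = 1` for `0 ≤ u ≤ 1` and
`u ρ'(u) = -ρ(u - 1)` for `u > 1`, that is, `ρ(u) = 1 - ∫_1^u ρ(t - 1) / t dt` for `u ≥ 1`;
extended by `ρ(u) = 0` for `u < 0`. -/
def dickman (u : ℝ) : ℝ := dickmanIter ⌊u⌋₊ u

/-- The derivative `ρ'`, taken as a right derivative. This is the usual derivative for
`u ≠ 0, 1`, and gives the right-continuous choice at `u = 0` and `u = 1`. -/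
def dickmanDeriv (u : ℝ) : ℝ := derivWithin dickman (Set.Ici u) u

/-- Iterates of the integral equation of Buchstab's function: `buchstabIter n` agrees with `ω` on
`(-∞, n + 2]`. -/
def buchstabIter : ℕ → ℝ → ℝ
  | 0 => fun u => if u < 1 then 0 else 1 / u
  | n + 1 => fun u =>
      if u < 1 then 0
      else (1 + ∫ t in (0 : ℝ)..(u - 1), buchstabIter n t) / u

/-- Buchstab's function `ω`: `ω(u) = 0` for `u < 1`, `u ω(u) = 1` for `1 ≤ u ≤ 2`, and
`(u ω(u))' = ω(u - 1)` for `u > 2` with `ω` continuous on `[1, ∞)`; that is,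
`u ω(u) = 1 + ∫_0^(u-1) ω(t) dt` for `u ≥ 1`. -/
def buchstab (u : ℝ) : ℝ := buchstabIter ⌊u⌋₊ u

/-- `Λ(x, y) = x ρ(u) - {x} - x ∫_0^u ρ'(u - v) {y^v} / y^v dv`, with `u = log x / log y`. -/
def Lambda (x y : ℝ) : ℝ :=
  x * dickman (Real.log x / Real.log y) - Int.fract x
    - x * ∫ v in (0 : ℝ)..(Real.log x / Real.log y),
        dickmanDeriv (Real.log x / Real.log y - v) * (Int.fract (y ^ v) / y ^ v)

/-- `μ_y(u) = ∫_0^u ω(u - v) y^(-v) dv`. -/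
def muInt (y u : ℝ) : ℝ := ∫ v in (0 : ℝ)..u, buchstab (u - v) * y ^ (-v)

/-- `Π(y) = ∏_{p ≤ y} (1 - 1 / p)`. -/
def PiProd (y : ℝ) : ℝ := ∏ p ∈ (Finset.Icc 1 ⌊y⌋₊).filter Nat.Prime, (1 - 1 / (p : ℝ))

/-- `V(x, y) = 1_{x ≥ 1} + x (Π(y) - e^(-γ) / log y + μ_y(u))`, with `u = log x / log y`. -/
def V (x y : ℝ) : ℝ :=
  (if 1 ≤ x then 1 else 0)
    + x * (PiProd y - Real.exp (-Real.eulerMascheroniConstant) / Real.log y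
        + muInt y (Real.log x / Real.log y))

/-- `V*(x, y) = 1_{x ≥ 1} + x μ_y(u)`, with `u = log x / log y`. -/
def VStar (x y : ℝ) : ℝ :=
  (if 1 ≤ x then 1 else 0) + x * muInt y (Real.log x / Real.log y)

/-- `Δ(x, y) = Ψ(x, y) - Λ(x, y)`. -/
def Delta (x y : ℝ) : ℝ := Psi x y - Lambda x y

/-- `Q(x, y) = V(x, y) - Φ(x, y)`. -/
def Q (x y : ℝ) : ℝ := V x y - Phi x y

/-- `Q*(x, y) = V*(x, y) - Φ(x, y)`. -/
def QStar (x y : ℝ) : ℝ := VStar x y - Phi x y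

/-- `R(x, y) = ∑_{n ∈ S_y} Q(x / n, y)`. -/
def R (x y : ℝ) : ℝ := ∑' n : smoothSet y, Q (x / ((n : ℕ) : ℝ)) y

/-- `R*(x, y) = ∑_{n ∈ S_y} Q*(x / n, y)`. -/
def RStar (x y : ℝ) : ℝ := ∑' n : smoothSet y, QStar (x / ((n : ℕ) : ℝ)) y

end SmoothRough

end

noncomputable section

namespace SmoothRough

open Set Filter Topology MeasureTheory

/-! On the scale `x = y^u`, put `S(u) = Ψ(y^u, y) / y^u`, `N(u) = ⌊y^u⌋ / y^u` and `r(u) = R*(y^u,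
y) / y^u`, and let `*` be convolution on `[0, u]`. Unique factorization into a smooth and a rough
part gives `∑ Φ(x/n, y) = ⌊x⌋` over smooth `n`, and hence `r = S + ω * S - N` (`RStar_rpow`).
Writing the fractional part as `y^v - ⌊y^v⌋` turns `Λ(y^u, y) / y^u` into `N + ρ' * N`
(`Lambda_rpow`).

The delay equations of `ρ` and `ω` imply `ρ' * ω = -(ρ' + ω)`
(`integral_dickmanSlope_mul_buchstab`), so `δ + ρ'` inverts `δ + ω`, where `δ` is the convolution
unit. Applying `δ + ρ'` to `r` therefore gives `r + ρ' * r = Δ(y^u, y) / y^u` (`Delta_rpow`). Since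
`-ρ' ≥ 0` has mass `1 - ρ(u) ≤ 1`, a bound for the remainder costs at most a factor 2
(`abs_Delta_le`).

The remainder is bounded termwise by means of `∑ 1/n = Π(y)⁻¹` over smooth `n`. The two versions
differ by `Q - Q* = x (Π(y) - e^(-γ) / log y)`, hence `R - R*` is a constant multiple of `x`. That
constant is controlled by the hypothesis at `x = 1`, because `Q*(1, y) = 0`. -/

/-! ### Dickman's function: integral equation, regularity, positivity. -/

theorem dickmanIter_succ_eq (n : ℕ) : ∀ u : ℝ, u < n + 1 →
    dickmanIter (n + 1) u = dickmanIter n u := by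
  induction n with
  | zero =>
    intro u hu
    have : u ≤ 1 := by norm_num at hu; exact hu.le
    simp [dickmanIter, this]
  | succ n ih =>
    intro u hu
    rw [dickmanIter]
    conv_rhs => rw [dickmanIter]
    by_cases h0 : u < 0
    · simp [h0]
    by_cases h1 : u ≤ 1
    · simp [h1]
    simp only [h0, h1, if_false]
    congr 1
    apply intervalIntegral.integral_congr
    intro t ht
    rw [uIcc_of_le (not_le.1 h1).le] at ht
    have : t - 1 < n + 1 := by have := ht.2; push_cast at hu; linarith
    simp only [ih _ this]

theorem dickmanIter_eq_of_le {n m : ℕ} (h : n ≤ m) {u : ℝ} (hu : u < n + 1) :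
    dickmanIter m u = dickmanIter n u := by
  induction m, h using Nat.le_induction with
  | base => rfl
  | succ m hm ih =>
    rw [dickmanIter_succ_eq m u, ih]
    have : (n : ℝ) ≤ m := by exact_mod_cast hm
    linarith

/-- Lets a single index `m` serve a whole range of integration, although the definition uses a floor
that varies with `u`. -/
theorem dickman_eq_iter {m : ℕ} {u : ℝ} (hu : u < m + 1) : dickman u = dickmanIter m u := by
  rw [dickman]
  rcases le_total ⌊u⌋₊ m with h | h
  · exact (dickmanIter_eq_of_le h (Nat.lt_floor_add_one u)).symm
  · exact dickmanIter_eq_of_le h hu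

theorem dickman_of_neg {u : ℝ} (hu : u < 0) : dickman u = 0 := by
  rw [dickman_eq_iter (m := 0) (by push_cast; linarith)]
  simp [dickmanIter, hu]

theorem dickman_of_le_one {u : ℝ} (h0 : 0 ≤ u) (h1 : u ≤ 1) : dickman u = 1 := by
  rw [dickman_eq_iter (m := 1) (by push_cast; linarith)]
  simp [dickmanIter, h0.not_gt, h1]

theorem dickman_eq_integral {u : ℝ} (hu : 1 ≤ u) :
    dickman u = 1 - ∫ t in (1 : ℝ)..u, dickman (t - 1) / t := by
  rcases hu.eq_or_lt with rfl | h1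
  · simp [dickman_of_le_one]
  have hm := Nat.lt_floor_add_one u
  rw [dickman_eq_iter (m := ⌊u⌋₊ + 1) (by push_cast; linarith), dickmanIter]
  simp only [not_lt.2 (zero_le_one.trans hu), not_le.2 h1, if_false]
  congr 1
  apply intervalIntegral.integral_congr
  intro t ht
  rw [uIcc_of_le hu] at ht
  have : t - 1 < ⌊u⌋₊ + 1 := by have := ht.2; linarith
  simp only [dickman_eq_iter this]

/-- Truncating the argument at 0 removes the jump there, so continuity and integrability hold on the
whole line without side conditions. -/
theorem continuous_dickmanIter_max (n : ℕ) : Continuous fun u : ℝ => dickmanIter n (max u 0) := by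
  induction n with
  | zero => simpa [dickmanIter] using continuous_const
  | succ n ih =>
    have hg : Continuous fun t : ℝ => dickmanIter n (max (t - 1) 0) / max t 1 :=
      (ih.comp (continuous_sub_right 1)).div (by fun_prop)
        fun t => (lt_of_lt_of_le one_pos (le_max_right t 1)).ne'
    have hc : Continuous fun u : ℝ =>
        1 - ∫ t in (1 : ℝ)..(max u 1), dickmanIter n (max (t - 1) 0) / max t 1 :=
      continuous_const.sub ((intervalIntegral.continuous_primitive
        (fun a b => hg.intervalIntegrable a b) 1).comp (by fun_prop))
    refine hc.congr fun u => ?_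
    rw [dickmanIter]
    simp only [not_lt.2 (le_max_right u 0), if_false]
    by_cases h1 : u ≤ 1
    · simp [h1]
    · have h1' := not_le.1 h1
      have : max u 0 = u := max_eq_left (by linarith)
      rw [this, max_eq_left h1'.le]
      simp only [h1, if_false]
      congr 1
      apply intervalIntegral.integral_congr
      intro t ht
      rw [uIcc_of_le h1'.le] at ht
      simp only [max_eq_left ht.1, max_eq_left (sub_nonneg.2 ht.1)]

theorem continuous_dickman_max : Continuous fun u : ℝ => dickman (max u 0) := by
  rw [continuous_iff_continuousAt]
  intro u
  obtain ⟨m, hm⟩ := exists_nat_gt u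
  refine (continuous_dickmanIter_max m).continuousAt.congr ?_
  filter_upwards [Iio_mem_nhds hm] with v hv
  have : max v 0 < m + 1 := max_lt (by have : v < m := hv; linarith) (by positivity)
  exact (dickman_eq_iter this).symm

theorem measurable_dickman : Measurable dickman := by
  have : dickman = (Ici (0 : ℝ)).indicator fun u => dickman (max u 0) := by
    ext u
    by_cases h : 0 ≤ u
    · simp [h]
    · simp [h, dickman_of_neg (not_le.1 h)]
  rw [this]
  exact continuous_dickman_max.measurable.indicator measurableSet_Ici

/-- The differentiable continuation of `dickman` from `[1, ∞)` to the whole line. -/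
def dickmanTail (u : ℝ) : ℝ := 1 - ∫ t in (1 : ℝ)..u, dickman (max (t - 1) 0) / max t 1

theorem dickman_eq_tail {u : ℝ} (hu : 1 ≤ u) : dickman u = dickmanTail u := by
  rw [dickman_eq_integral hu, dickmanTail]
  congr 1
  apply intervalIntegral.integral_congr
  intro t ht
  rw [uIcc_of_le hu] at ht
  simp only [max_eq_left ht.1, max_eq_left (sub_nonneg.2 ht.1)]

theorem continuous_tail_integrand :
    Continuous fun t : ℝ => dickman (max (t - 1) 0) / max t 1 :=
  (continuous_dickman_max.comp (continuous_sub_right 1)).div (by fun_prop)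
    fun t => (lt_of_lt_of_le one_pos (le_max_right t 1)).ne'

theorem hasDerivAt_dickmanTail (u : ℝ) :
    HasDerivAt dickmanTail (-(dickman (max (u - 1) 0) / max u 1)) u := by
  have := intervalIntegral.integral_hasDerivAt_right
    (continuous_tail_integrand.intervalIntegrable 1 u)
    continuous_tail_integrand.stronglyMeasurable.stronglyMeasurableAtFilter
    continuous_tail_integrand.continuousAt
  exact this.const_sub 1

/-- The difference of the two sides has derivative `ρ(v) + v ρ'(v) - ρ(v) + ρ(v - 1) = 0`, and both
sides equal 1 at `u = 1`. -/
theorem mul_dickman_eq_integral {u : ℝ} (hu : 1 ≤ u) :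
    u * dickman u = ∫ t in (u - 1)..u, dickman (max t 0) := by
  have hP : ∀ v : ℝ, HasDerivAt (fun w => ∫ t in (0 : ℝ)..w, dickman (max t 0))
      (dickman (max v 0)) v := fun v =>
    intervalIntegral.integral_hasDerivAt_right
      (continuous_dickman_max.intervalIntegrable _ _)
      continuous_dickman_max.stronglyMeasurable.stronglyMeasurableAtFilter
      continuous_dickman_max.continuousAt
  have hF : ∀ v : ℝ, HasDerivAt (fun w => w * dickmanTail w
      - ((∫ t in (0 : ℝ)..w, dickman (max t 0)) - ∫ t in (0 : ℝ)..(w - 1), dickman (max t 0)))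
      (1 * dickmanTail v + v * (-(dickman (max (v - 1) 0) / max v 1))
        - (dickman (max v 0) - dickman (max (v - 1) 0))) v := fun v =>
    ((hasDerivAt_id v).mul (hasDerivAt_dickmanTail v)).sub
      ((hP v).sub ((hP (v - 1)).comp_sub_const v 1))
  have hconst := constant_of_has_deriv_right_zero (a := 1) (b := u)
    (fun v _ => (hF v).continuousAt.continuousWithinAt) (fun v hv => by
      have h1 : (1 : ℝ) ≤ v := hv.1
      have : (1 * dickmanTail v + v * (-(dickman (max (v - 1) 0) / max v 1))
        - (dickman (max v 0) - dickman (max (v - 1) 0))) = 0 := by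
        rw [← dickman_eq_tail h1, max_eq_left h1, max_eq_left (zero_le_one.trans h1)]
        have : v ≠ 0 := by positivity
        field_simp
        ring
      exact ((hF v).congr_deriv this).hasDerivWithinAt) u ⟨hu, le_rfl⟩
  have h1 : (∫ t in (0 : ℝ)..1, dickman (max t 0)) = 1 := by
    rw [intervalIntegral.integral_congr (g := fun _ => (1 : ℝ))]
    · simp
    · intro t ht
      rw [uIcc_of_le zero_le_one] at ht
      simp only [max_eq_left ht.1, dickman_of_le_one ht.1 ht.2]
  rw [intervalIntegral.integral_interval_sub_left
    (continuous_dickman_max.intervalIntegrable _ _)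
    (continuous_dickman_max.intervalIntegrable _ _)] at hconst
  have ht : dickmanTail 1 = 1 := by simp [dickmanTail]
  rw [← dickman_eq_tail hu, ht] at hconst
  simp only [h1, intervalIntegral.integral_same, sub_self, sub_zero, one_mul] at hconst
  linarith

theorem dickman_sub_dickman {a b : ℝ} (ha : 1 ≤ a) (hab : a ≤ b) :
    dickman a - dickman b = ∫ t in a..b, dickman (max (t - 1) 0) / max t 1 := by
  rw [dickman_eq_tail ha, dickman_eq_tail (ha.trans hab), dickmanTail, dickmanTail,
    sub_sub_sub_cancel_left, intervalIntegral.integral_interval_sub_left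
    (continuous_tail_integrand.intervalIntegrable _ _)
    (continuous_tail_integrand.intervalIntegrable _ _)]

/-- Induction by unit steps. If `ρ ≥ 0` up to `n + 1`, then `ρ' = -ρ(t - 1) / t` makes `ρ` decrease
on `[n + 1, u]` for `u ≤ n + 2`. Hence `u ρ(u) = ∫_(u-1)^u ρ ≥ (u - n - 1) ρ(u)`, that is, `(n + 1)
ρ(u) ≥ 0`. -/
theorem dickman_nonneg (u : ℝ) : 0 ≤ dickman u := by
  have key : ∀ n : ℕ, ∀ u : ℝ, u ≤ n + 1 → 0 ≤ dickman u := by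
    intro n
    induction n with
    | zero =>
      intro u hu
      rcases lt_or_ge u 0 with h | h
      · rw [dickman_of_neg h]
      · rw [dickman_of_le_one h (by simpa using hu)]; exact zero_le_one
    | succ n ih =>
      intro u hu
      push_cast at hu
      rcases le_or_gt u (n + 1) with h | h
      · exact ih u h
      have hn : (0 : ℝ) ≤ n := n.cast_nonneg
      have hu1 : 1 ≤ u := by linarith
      have hanti : ∀ t ∈ Icc ((n : ℝ) + 1) u, dickman u ≤ dickman (max t 0) := by
        intro t ht
        rw [max_eq_left (by linarith [ht.1])]
        rw [← sub_nonneg, dickman_sub_dickman (by linarith [ht.1]) ht.2]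
        refine intervalIntegral.integral_nonneg ht.2 fun s hs => div_nonneg (ih _ ?_) ?_
        · exact max_le (by linarith [hs.2]) (by linarith)
        · exact zero_le_one.trans (le_max_right _ _)
      have h2 : (u - (n + 1)) * dickman u ≤ ∫ t in ((n : ℝ) + 1)..u, dickman (max t 0) := by
        have := intervalIntegral.integral_mono_on h.le (by simp : IntervalIntegrable (fun _ => dickman u) volume _ _)
          (continuous_dickman_max.intervalIntegrable _ _) hanti
        simpa using this
      have h3 : 0 ≤ ∫ t in (u - 1)..((n : ℝ) + 1), dickman (max t 0) :=
        intervalIntegral.integral_nonneg (by linarith) fun t ht =>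
          ih _ (max_le ht.2 (by linarith))
      have h4 := mul_dickman_eq_integral hu1
      rw [← intervalIntegral.integral_add_adjacent_intervals (b := (n : ℝ) + 1)
        (continuous_dickman_max.intervalIntegrable _ _)
        (continuous_dickman_max.intervalIntegrable _ _)] at h4
      have h5 : 0 ≤ ((n : ℝ) + 1) * dickman u := by linarith
      exact nonneg_of_mul_nonneg_right h5 (by linarith)
  exact key ⌊u⌋₊ u (Nat.lt_floor_add_one u).le

theorem dickman_le_one (u : ℝ) : dickman u ≤ 1 := by
  rcases lt_or_ge u 0 with h | h
  · rw [dickman_of_neg h]; exact zero_le_one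
  rcases le_total u 1 with h1 | h1
  · rw [dickman_of_le_one h h1]
  have h2 := dickman_sub_dickman le_rfl h1
  rw [dickman_of_le_one zero_le_one le_rfl] at h2
  have : 0 ≤ ∫ t in (1 : ℝ)..u, dickman (max (t - 1) 0) / max t 1 :=
    intervalIntegral.integral_nonneg h1 fun s _ =>
      div_nonneg (dickman_nonneg _) (zero_le_one.trans (le_max_right _ _))
  linarith

/-- The derivative of `dickman` away from `0` and `1`. -/
def dickmanSlope (v : ℝ) : ℝ := -(dickman (v - 1) / v)

theorem dickmanSlope_of_lt_one {v : ℝ} (hv : v < 1) : dickmanSlope v = 0 := by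
  rw [dickmanSlope, dickman_of_neg (by linarith)]; simp

theorem mul_dickmanSlope (v : ℝ) : v * dickmanSlope v = -dickman (v - 1) := by
  rcases eq_or_ne v 0 with rfl | h
  · rw [dickman_of_neg (by norm_num)]; simp
  · rw [dickmanSlope]; field_simp

theorem measurable_dickmanSlope : Measurable dickmanSlope :=
  ((measurable_dickman.comp (measurable_id.sub_const 1)).div measurable_id).neg

theorem dickmanSlope_nonpos (v : ℝ) : dickmanSlope v ≤ 0 := by
  rcases lt_or_ge v 1 with h | h
  · rw [dickmanSlope_of_lt_one h]
  · exact neg_nonpos.2 (div_nonneg (dickman_nonneg _) (by linarith))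

theorem abs_dickmanSlope_le (v : ℝ) : |dickmanSlope v| ≤ 1 := by
  rcases lt_or_ge v 1 with h | h
  · rw [dickmanSlope_of_lt_one h]; simp
  · rw [dickmanSlope, abs_neg, abs_of_nonneg (div_nonneg (dickman_nonneg _) (by linarith))]
    exact div_le_one_of_le₀ ((dickman_le_one _).trans h) (by linarith)

theorem hasDerivAt_dickman {v : ℝ} (h0 : 0 < v) (h1 : v ≠ 1) :
    HasDerivAt dickman (dickmanSlope v) v := by
  rcases lt_or_gt_of_ne h1 with h | h
  · rw [dickmanSlope_of_lt_one h]
    refine (hasDerivAt_const v (1 : ℝ)).congr_of_eventuallyEq ?_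
    filter_upwards [Ioo_mem_nhds h0 h] with w hw
    exact dickman_of_le_one hw.1.le hw.2.le
  · have := hasDerivAt_dickmanTail v
    rw [max_eq_left h.le, max_eq_left (sub_nonneg.2 h.le)] at this
    refine this.congr_of_eventuallyEq ?_
    filter_upwards [Ioi_mem_nhds h] with w hw
    exact dickman_eq_tail (le_of_lt hw)

theorem dickmanDeriv_eq {v : ℝ} (h0 : 0 < v) (h1 : v ≠ 1) : dickmanDeriv v = dickmanSlope v :=
  (hasDerivAt_dickman h0 h1).hasDerivWithinAt.derivWithin (uniqueDiffOn_Ici v v self_mem_Ici)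

theorem continuousOn_dickman : ContinuousOn dickman (Ici 0) :=
  continuous_dickman_max.continuousOn.congr fun u hu => by
    simp only [max_eq_left (show (0 : ℝ) ≤ u from hu)]

theorem intervalIntegrable_of_bounded {g : ℝ → ℝ} (hg : Measurable g) {C : ℝ}
    (hC : ∀ v, |g v| ≤ C) (a b : ℝ) : IntervalIntegrable g volume a b :=
  (intervalIntegrable_const (c := C)).mono_fun hg.aestronglyMeasurable
    (ae_of_all _ fun v => by
      simpa [Real.norm_eq_abs] using (hC v).trans (le_abs_self C))

/-- The kink of `ρ` at 1 is a single exceptional point for the fundamental theorem of calculus. As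
the slope has constant sign, this is also its total mass, which yields the factor 2 at the end. -/
theorem integral_dickmanSlope {u : ℝ} (hu : 0 ≤ u) :
    ∫ v in (0 : ℝ)..u, dickmanSlope v = dickman u - 1 := by
  rw [integral_eq_of_hasDerivAt_off_countable_of_le dickman dickmanSlope hu
    (countable_singleton (1 : ℝ)) (continuousOn_dickman.mono Icc_subset_Ici_self)
    (fun v hv => hasDerivAt_dickman hv.1.1 hv.2)
    (intervalIntegrable_of_bounded measurable_dickmanSlope abs_dickmanSlope_le _ _),
    dickman_of_le_one le_rfl zero_le_one]

/-! ### Buchstab's function: integral equation, bounds, regularity. -/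

theorem buchstabIter_succ_eq (n : ℕ) : ∀ u : ℝ, u < n + 2 →
    buchstabIter (n + 1) u = buchstabIter n u := by
  induction n with
  | zero =>
    intro u hu
    rw [buchstabIter, buchstabIter]
    by_cases h1 : u < 1
    · simp [h1]
    simp only [h1, if_false]
    rw [intervalIntegral.integral_congr (g := fun _ => (0 : ℝ))]
    · simp
    · intro t ht
      rw [uIcc_of_le (by linarith)] at ht
      have : t < 1 := by have := ht.2; norm_num at hu; linarith
      simp [buchstabIter, this]
  | succ n ih =>
    intro u hu
    rw [buchstabIter]
    conv_rhs => rw [buchstabIter]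
    by_cases h1 : u < 1
    · simp [h1]
    simp only [h1, if_false]
    congr 2
    apply intervalIntegral.integral_congr
    intro t ht
    rw [uIcc_of_le (by linarith)] at ht
    have : t < n + 2 := by have := ht.2; push_cast at hu; linarith
    simp only [ih _ this]

theorem buchstabIter_eq_of_le {n m : ℕ} (h : n ≤ m) {u : ℝ} (hu : u < n + 2) :
    buchstabIter m u = buchstabIter n u := by
  induction m, h using Nat.le_induction with
  | base => rfl
  | succ m hm ih =>
    rw [buchstabIter_succ_eq m u, ih]
    have : (n : ℝ) ≤ m := by exact_mod_cast hm
    linarith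

theorem buchstab_eq_iter {m : ℕ} {u : ℝ} (hu : u < m + 2) : buchstab u = buchstabIter m u := by
  rw [buchstab]
  rcases le_total ⌊u⌋₊ m with h | h
  · refine (buchstabIter_eq_of_le h ?_).symm
    linarith [Nat.lt_floor_add_one u]
  · exact buchstabIter_eq_of_le h hu

theorem buchstab_of_lt_one {u : ℝ} (hu : u < 1) : buchstab u = 0 := by
  rw [buchstab_eq_iter (m := 0) (by push_cast; linarith)]
  simp [buchstabIter, hu]

theorem mul_buchstab_eq {u : ℝ} (hu : 1 ≤ u) :
    u * buchstab u = 1 + ∫ t in (0 : ℝ)..(u - 1), buchstab t := by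
  have hm := Nat.lt_floor_add_one u
  rw [buchstab_eq_iter (m := ⌊u⌋₊ + 1) (by push_cast; linarith), buchstabIter]
  simp only [not_lt.2 hu, if_false]
  rw [mul_div_cancel₀ _ (by positivity)]
  congr 1
  apply intervalIntegral.integral_congr
  intro t ht
  rw [uIcc_of_le (by linarith)] at ht
  have : t < ⌊u⌋₊ + 2 := by have := ht.2; linarith
  simp only [buchstab_eq_iter this]

/-- The bound 1 reproduces itself: `1 + ∫_0^(u-1) ω ≤ 1 + (u - 1) = u`. Measurability is carried
along because the integral estimate needs integrability. -/
theorem buchstabIter_aux (n : ℕ) : Measurable (buchstabIter n) ∧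
    ∀ u, 0 ≤ buchstabIter n u ∧ buchstabIter n u ≤ 1 := by
  induction n with
  | zero =>
    constructor
    · exact Measurable.ite measurableSet_Iio measurable_const (measurable_const.div measurable_id)
    · intro u
      rw [buchstabIter]
      beta_reduce
      split_ifs with h
      · simp
      · have : 1 ≤ u := not_lt.1 h
        exact ⟨by positivity, div_le_one_of_le₀ this (by positivity)⟩
  | succ n ih =>
    have hi : ∀ a b, IntervalIntegrable (buchstabIter n) volume a b :=
      intervalIntegrable_of_bounded ih.1 (C := 1) fun v => by
        rw [abs_of_nonneg (ih.2 v).1]; exact (ih.2 v).2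
    constructor
    · refine Measurable.ite measurableSet_Iio measurable_const (Measurable.div ?_ measurable_id)
      have := (intervalIntegral.continuous_primitive hi 0).comp (continuous_sub_right (1 : ℝ))
      exact (continuous_const.add this).measurable
    · intro u
      rw [buchstabIter]
      beta_reduce
      split_ifs with h
      · simp
      · have h1 : 1 ≤ u := not_lt.1 h
        have h2 : 0 ≤ ∫ t in (0 : ℝ)..(u - 1), buchstabIter n t :=
          intervalIntegral.integral_nonneg (by linarith) fun t _ => (ih.2 t).1
        have h3 : ∫ t in (0 : ℝ)..(u - 1), buchstabIter n t ≤ ∫ t in (0 : ℝ)..(u - 1), (1 : ℝ) :=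
          intervalIntegral.integral_mono_on (by linarith) (hi _ _) (by simp)
            fun t _ => (ih.2 t).2
        simp only [intervalIntegral.integral_const, smul_eq_mul, mul_one, sub_zero] at h3
        exact ⟨by positivity, div_le_one_of_le₀ (by linarith) (by positivity)⟩

theorem buchstab_nonneg (u : ℝ) : 0 ≤ buchstab u := ((buchstabIter_aux _).2 u).1

theorem buchstab_le_one (u : ℝ) : buchstab u ≤ 1 := ((buchstabIter_aux _).2 u).2

theorem abs_buchstab_le (u : ℝ) : |buchstab u| ≤ 1 := by
  rw [abs_of_nonneg (buchstab_nonneg u)]; exact buchstab_le_one u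

theorem measurable_buchstab : Measurable buchstab := by
  refine measurable_of_tendsto_metrizable (fun n => (buchstabIter_aux n).1) ?_
  rw [tendsto_pi_nhds]
  intro u
  refine tendsto_const_nhds.congr' ?_
  filter_upwards [eventually_ge_atTop ⌊u⌋₊] with n hn
  refine buchstab_eq_iter ?_
  have h1 := Nat.lt_floor_add_one u
  have h2 : (⌊u⌋₊ : ℝ) ≤ n := by exact_mod_cast hn
  linarith

theorem intervalIntegrable_buchstab (a b : ℝ) : IntervalIntegrable buchstab volume a b :=
  intervalIntegrable_of_bounded measurable_buchstab abs_buchstab_le a b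

theorem continuousAt_buchstab {u : ℝ} (hu : u ≠ 1) : ContinuousAt buchstab u := by
  rcases lt_or_gt_of_ne hu with h | h
  · refine (continuousAt_const (y := (0 : ℝ))).congr ?_
    filter_upwards [Iio_mem_nhds h] with w hw
    exact (buchstab_of_lt_one hw).symm
  · have hc : ContinuousAt (fun w : ℝ => (1 + ∫ t in (0 : ℝ)..(w - 1), buchstab t) / w) u := by
      refine ContinuousAt.div ?_ continuousAt_id (by positivity)
      exact (continuous_const.add ((intervalIntegral.continuous_primitive
        intervalIntegrable_buchstab 0).comp (continuous_sub_right (1 : ℝ)))).continuousAt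
    refine hc.congr ?_
    filter_upwards [Ioi_mem_nhds h] with w hw
    have hw1 : 1 < w := hw
    rw [← mul_buchstab_eq hw1.le]
    field_simp

theorem hasDerivAt_integral_buchstab {u : ℝ} (hu : u ≠ 1) :
    HasDerivAt (fun w => ∫ t in (0 : ℝ)..w, buchstab t) (buchstab u) u :=
  intervalIntegral.integral_hasDerivAt_right (intervalIntegrable_buchstab _ _)
    measurable_buchstab.stronglyMeasurable.stronglyMeasurableAtFilter (continuousAt_buchstab hu)

/-! ### The convolution inverse of Buchstab's kernel. -/

/-- The integrand is the derivative of `ρ(t - r) W(r)` with `W(r) = 1 + ∫_0^r ω`. It may fail to be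
so only at `r = 1`, where `ω` jumps, and at `r = t - 1`, where `ρ` has its kink. -/
theorem integral_dickman_mul_integral_buchstab {t : ℝ} (ht : 0 ≤ t) :
    ∫ r in (0 : ℝ)..t, (-(dickmanSlope (t - r) * (1 + ∫ s in (0 : ℝ)..r, buchstab s))
        + dickman (t - r) * buchstab r)
      = (1 + ∫ s in (0 : ℝ)..t, buchstab s) - dickman t := by
  have hW : Continuous fun r => 1 + ∫ s in (0 : ℝ)..r, buchstab s :=
    continuous_const.add (intervalIntegral.continuous_primitive intervalIntegrable_buchstab 0)
  have hD : Measurable fun r => dickmanSlope (t - r) :=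
    measurable_dickmanSlope.comp (measurable_const.sub measurable_id)
  have hρ : Measurable fun r => dickman (t - r) :=
    measurable_dickman.comp (measurable_const.sub measurable_id)
  rw [integral_eq_of_hasDerivAt_off_countable_of_le
    (fun r => dickman (t - r) * (1 + ∫ s in (0 : ℝ)..r, buchstab s)) _ ht
    (s := {1, t - 1}) (Set.Countable.insert _ (countable_singleton _))]
  · simp [dickman_of_le_one]
  · refine ContinuousOn.mul ?_ hW.continuousOn
    exact continuousOn_dickman.comp (by fun_prop) fun r hr => sub_nonneg.2 hr.2
  · intro r hr
    have h1 : r ≠ 1 := fun h => hr.2 (by simp [h])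
    have h2 : t - r ≠ 1 := fun h => hr.2 (by
      right; rw [mem_singleton_iff]; linarith)
    have h3 := (hasDerivAt_dickman (sub_pos.2 hr.1.2) h2).comp_const_sub t r
    have h4 := (hasDerivAt_integral_buchstab h1).const_add 1
    exact (h3.mul h4).congr_deriv (by ring)
  · refine IntervalIntegrable.add ?_ ?_
    · exact ((intervalIntegrable_of_bounded hD (fun r => abs_dickmanSlope_le _) 0 t).mul_continuousOn
        hW.continuousOn).neg
    · refine intervalIntegrable_of_bounded (hρ.mul measurable_buchstab) (C := 1) (fun v => ?_) 0 t
      rw [Pi.mul_apply, abs_mul, abs_of_nonneg (dickman_nonneg _)]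
      exact mul_le_one₀ (dickman_le_one _) (abs_nonneg _) (abs_buchstab_le _)

/-- The convolution identity `ρ' * ω = -(ρ' + ω)`. -/
theorem integral_dickmanSlope_mul_buchstab {u : ℝ} (hu : 0 < u) :
    ∫ s in (0 : ℝ)..u, dickmanSlope (u - s) * buchstab s = -(dickmanSlope u + buchstab u) := by
  rcases lt_or_ge u 1 with h1 | h1
  · rw [dickmanSlope_of_lt_one h1, buchstab_of_lt_one h1,
      intervalIntegral.integral_congr (g := fun _ => (0 : ℝ))]
    · simp
    · intro s hs
      rw [uIcc_of_le hu.le] at hs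
      simp [buchstab_of_lt_one (hs.2.trans_lt h1)]
  -- Multiply by `u = (u - s) + s` and apply the delay equations `(u - s) ρ'(u - s) = -ρ(u - s - 1)`
  -- and `s ω(s) = W(s - 1)`, with `W(r) = 1 + ∫_0^r ω`. Both resulting integrals reduce to `[0, u -
  -- 1]`, and the preceding lemma at `t = u - 1` evaluates their sum as `ρ(u - 1) - W(u - 1) = -u
  -- ρ'(u) - u ω(u)`.
  refine mul_left_cancel₀ hu.ne' ?_
  have hD : Measurable fun r => dickmanSlope (u - r) :=
    measurable_dickmanSlope.comp (measurable_const.sub measurable_id)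
  have hρ : Measurable fun r => dickman (u - 1 - r) :=
    measurable_dickman.comp (measurable_const.sub measurable_id)
  have hρω : ∀ a b, IntervalIntegrable (fun s => dickman (u - 1 - s) * buchstab s) volume a b := by
    refine intervalIntegrable_of_bounded (hρ.mul measurable_buchstab) (C := 1) (fun v => ?_)
    rw [abs_mul, abs_of_nonneg (dickman_nonneg _)]
    exact mul_le_one₀ (dickman_le_one _) (abs_nonneg _) (abs_buchstab_le _)
  have hDω : ∀ a b, IntervalIntegrable (fun s => dickmanSlope (u - s) * (s * buchstab s))
      volume a b := by
    intro a b
    have : IntervalIntegrable (fun s => dickmanSlope (u - s) * buchstab s) volume a b := by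
      refine intervalIntegrable_of_bounded (hD.mul measurable_buchstab) (C := 1) (fun v => ?_) _ _
      rw [Pi.mul_apply, abs_mul]
      exact mul_le_one₀ (abs_dickmanSlope_le _) (abs_nonneg _) (abs_buchstab_le _)
    exact (this.mul_continuousOn continuousOn_id).congr (fun s _ => by simp; ring)
  have hsplit : u * ∫ s in (0 : ℝ)..u, dickmanSlope (u - s) * buchstab s
      = (∫ s in (0 : ℝ)..u, -(dickman (u - 1 - s) * buchstab s))
        + ∫ s in (0 : ℝ)..u, dickmanSlope (u - s) * (s * buchstab s) := by
    rw [← intervalIntegral.integral_const_mul, intervalIntegral.integral_neg, neg_add_eq_sub,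
      ← intervalIntegral.integral_sub (hDω _ _) (hρω _ _)]
    refine intervalIntegral.integral_congr fun s _ => ?_
    have := mul_dickmanSlope (u - s)
    rw [show u - s - 1 = u - 1 - s by ring] at this
    linear_combination buchstab s * this
  have hA : (∫ s in (0 : ℝ)..u, -(dickman (u - 1 - s) * buchstab s))
      = -∫ s in (0 : ℝ)..(u - 1), dickman (u - 1 - s) * buchstab s := by
    rw [intervalIntegral.integral_neg, ← intervalIntegral.integral_add_adjacent_intervals
      (hρω 0 (u - 1)) (hρω (u - 1) u), add_eq_left.2]
    rw [intervalIntegral.integral_of_le (by linarith)]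
    refine setIntegral_eq_zero_of_forall_eq_zero fun s hs => ?_
    rw [dickman_of_neg (by linarith [hs.1]), zero_mul]
  have hB : (∫ s in (0 : ℝ)..u, dickmanSlope (u - s) * (s * buchstab s))
      = ∫ r in (0 : ℝ)..(u - 1),
          dickmanSlope (u - 1 - r) * (1 + ∫ s in (0 : ℝ)..r, buchstab s) := by
    rw [← intervalIntegral.integral_add_adjacent_intervals (hDω 0 1) (hDω 1 u), add_eq_right.2]
    · have := intervalIntegral.integral_comp_sub_right (a := 1) (b := u)
        (fun r => dickmanSlope (u - 1 - r) * (1 + ∫ s in (0 : ℝ)..r, buchstab s)) 1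
      rw [sub_self] at this
      rw [← this]
      refine intervalIntegral.integral_congr fun s hs => ?_
      rw [uIcc_of_le h1] at hs
      simp only [mul_buchstab_eq hs.1, show u - 1 - (s - 1) = u - s by ring]
    · rw [intervalIntegral.integral_of_le zero_le_one, integral_Ioc_eq_integral_Ioo]
      refine setIntegral_eq_zero_of_forall_eq_zero fun s hs => ?_
      rw [buchstab_of_lt_one hs.2, mul_zero, mul_zero]
  have hFTC := integral_dickman_mul_integral_buchstab (sub_nonneg.2 h1)
  have hW : Continuous fun r => 1 + ∫ s in (0 : ℝ)..r, buchstab s :=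
    continuous_const.add (intervalIntegral.continuous_primitive intervalIntegrable_buchstab 0)
  rw [intervalIntegral.integral_add _ (hρω _ _), intervalIntegral.integral_neg] at hFTC
  · rw [hsplit, hA, hB, mul_neg, mul_add, mul_dickmanSlope, mul_buchstab_eq h1]
    linarith
  · exact ((intervalIntegrable_of_bounded (measurable_dickmanSlope.comp
      (measurable_const.sub measurable_id)) (fun r => abs_dickmanSlope_le _) _ _).mul_continuousOn
        hW.continuousOn).neg

/-- Associativity of the convolution product on `[0, u]`. -/
theorem integral_mul_integral_mul {a b p : ℝ → ℝ} (ha : Measurable a) (hb : Measurable b)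
    (hp : Measurable p) {A B P : ℝ} (hA : ∀ v, |a v| ≤ A) (hB : ∀ v, |b v| ≤ B)
    (hP : ∀ v, |p v| ≤ P) (hb0 : ∀ v < 0, b v = 0) {u : ℝ} (hu : 0 ≤ u) :
    IntervalIntegrable (fun v => a (u - v) * ∫ w in (0 : ℝ)..v, b (v - w) * p w) volume 0 u ∧
    ∫ v in (0 : ℝ)..u, a (u - v) * ∫ w in (0 : ℝ)..v, b (v - w) * p w
      = ∫ w in (0 : ℝ)..u, (∫ s in (0 : ℝ)..(u - w), a (u - w - s) * b s) * p w := by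
  have hA0 : 0 ≤ A := (abs_nonneg _).trans (hA 0)
  have hB0 : 0 ≤ B := (abs_nonneg _).trans (hB 0)
  have hm : Measurable fun z : ℝ × ℝ => a (u - z.1) * (b (z.1 - z.2) * p z.2) :=
    (ha.comp (measurable_const.sub measurable_fst)).mul
      ((hb.comp (measurable_fst.sub measurable_snd)).mul (hp.comp measurable_snd))
  have hint : Integrable (Function.uncurry fun v w : ℝ => a (u - v) * (b (v - w) * p w))
      ((volume.restrict (Ioc 0 u)).prod (volume.restrict (Ioc 0 u))) := by
    refine Integrable.of_bound hm.aestronglyMeasurable (A * (B * P)) (ae_of_all _ fun z => ?_)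
    simp only [Function.uncurry, Real.norm_eq_abs, abs_mul]
    exact mul_le_mul (hA _) (mul_le_mul (hB _) (hP _) (abs_nonneg _) hB0) (by positivity) hA0
  have hbp : ∀ v c d, IntervalIntegrable (fun w => b (v - w) * p w) volume c d := fun v =>
    intervalIntegrable_of_bounded ((hb.comp (measurable_const.sub measurable_id)).mul hp)
      (C := B * P) fun w => by
        rw [abs_mul]; exact mul_le_mul (hB _) (hP _) (abs_nonneg _) hB0
  have hab : ∀ w c d, IntervalIntegrable (fun v => a (u - v) * b (v - w)) volume c d := fun w =>
    intervalIntegrable_of_bounded ((ha.comp (measurable_const.sub measurable_id)).mul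
      (hb.comp (measurable_id.sub_const w))) (C := A * B) fun v => by
        rw [abs_mul]; exact mul_le_mul (hA _) (hB _) (abs_nonneg _) hA0
  -- As `b` vanishes on negative arguments, the triangle `w ≤ v` can be enlarged to the square `(0,
  -- u]²`, where Fubini applies directly.
  have hleft : ∀ v ∈ Ioc 0 u, (a (u - v) * ∫ w in (0 : ℝ)..v, b (v - w) * p w)
      = ∫ w in Ioc 0 u, a (u - v) * (b (v - w) * p w) := by
    intro v hv
    rw [integral_const_mul, ← intervalIntegral.integral_of_le hu,
      ← intervalIntegral.integral_add_adjacent_intervals (hbp v 0 v) (hbp v v u)]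
    congr 1
    refine (add_eq_left.2 ?_).symm
    rw [intervalIntegral.integral_of_le hv.2]
    refine setIntegral_eq_zero_of_forall_eq_zero fun s hs => ?_
    rw [hb0 _ (by linarith [hs.1]), zero_mul]
  have hright : ∀ w ∈ Ioc 0 u, (∫ s in (0 : ℝ)..(u - w), a (u - w - s) * b s) * p w
      = ∫ v in Ioc 0 u, a (u - v) * (b (v - w) * p w) := by
    intro w hw
    simp only [← mul_assoc]
    rw [integral_mul_const, ← intervalIntegral.integral_of_le hu,
      ← intervalIntegral.integral_add_adjacent_intervals (hab w 0 w) (hab w w u)]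
    congr 1
    have h0 : ∫ v in (0 : ℝ)..w, a (u - v) * b (v - w) = 0 := by
      rw [intervalIntegral.integral_of_le hw.1.le, integral_Ioc_eq_integral_Ioo]
      refine setIntegral_eq_zero_of_forall_eq_zero fun s hs => ?_
      rw [hb0 _ (by linarith [hs.2]), mul_zero]
    have h1 := intervalIntegral.integral_comp_sub_right (a := w) (b := u)
      (fun s => a (u - w - s) * b s) w
    rw [sub_self] at h1
    rw [h0, zero_add, ← h1]
    refine intervalIntegral.integral_congr fun s _ => ?_
    simp only [show u - w - (s - w) = u - s by ring]
  refine ⟨(intervalIntegrable_iff_integrableOn_Ioc_of_le hu).2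
    (IntegrableOn.congr_fun hint.integral_prod_left (fun v hv => (hleft v hv).symm)
      measurableSet_Ioc), ?_⟩
  rw [intervalIntegral.integral_of_le hu, intervalIntegral.integral_of_le hu,
    setIntegral_congr_fun measurableSet_Ioc hleft, setIntegral_congr_fun measurableSet_Ioc hright]
  exact integral_integral_swap hint

/-- Associativity and the convolution identity: `ρ' * (ω * p) = (ρ' * ω) * p = -(ρ' + ω) * p`. -/
theorem integral_dickmanSlope_mul_integral_buchstab {p : ℝ → ℝ} (hp : Measurable p) {P : ℝ}
    (hP : ∀ v, |p v| ≤ P) {u : ℝ} (hu : 0 ≤ u) :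
    IntervalIntegrable (fun v => dickmanSlope (u - v) * ∫ w in (0 : ℝ)..v, buchstab (v - w) * p w)
      volume 0 u ∧
    ∫ v in (0 : ℝ)..u, dickmanSlope (u - v) * ∫ w in (0 : ℝ)..v, buchstab (v - w) * p w
      = -((∫ w in (0 : ℝ)..u, dickmanSlope (u - w) * p w)
        + ∫ w in (0 : ℝ)..u, buchstab (u - w) * p w) := by
  have h1 : ∀ {g : ℝ → ℝ}, Measurable g → (∀ v, |g v| ≤ 1) →
      IntervalIntegrable (fun w => g (u - w) * p w) volume 0 u := fun hg hg1 =>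
    intervalIntegrable_of_bounded ((hg.comp (measurable_const.sub measurable_id)).mul hp)
      (C := 1 * P) (fun w => by
        rw [Pi.mul_apply, abs_mul]; exact mul_le_mul (hg1 _) (hP _) (abs_nonneg _) zero_le_one) _ _
  obtain ⟨hI, heq⟩ := integral_mul_integral_mul measurable_dickmanSlope measurable_buchstab hp
    abs_dickmanSlope_le abs_buchstab_le hP (fun v hv => buchstab_of_lt_one (by linarith)) hu
  refine ⟨hI, ?_⟩
  rw [heq,
    ← intervalIntegral.integral_add (h1 measurable_dickmanSlope abs_dickmanSlope_le)
      (h1 measurable_buchstab abs_buchstab_le), ← intervalIntegral.integral_neg,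
    intervalIntegral.integral_of_le hu, intervalIntegral.integral_of_le hu,
    -- The convolution identity is stated only for positive argument `u - w`, so the null endpoint
    -- `w = u` is dropped.
    integral_Ioc_eq_integral_Ioo, integral_Ioc_eq_integral_Ioo]
  refine setIntegral_congr_fun measurableSet_Ioo fun w hw => ?_
  simp only [integral_dickmanSlope_mul_buchstab (sub_pos.2 hw.2)]
  ring

/-! ### Smooth and rough numbers: factorization and the Euler product. -/

theorem finite_smooth_le (x y : ℝ) : {n : ℕ | n ∈ smoothSet y ∧ (n : ℝ) ≤ x}.Finite :=
  (finite_Iic ⌊x⌋₊).subset fun _ hn => Nat.le_floor hn.2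

theorem finite_rough_le (x y : ℝ) : {n : ℕ | n ∈ roughSet y ∧ (n : ℝ) ≤ x}.Finite :=
  (finite_Iic ⌊x⌋₊).subset fun _ hn => Nat.le_floor hn.2

/-- The smooth numbers up to `x` as a `Finset`. -/
def smoothUpTo (x y : ℝ) : Finset ℕ := (finite_smooth_le x y).toFinset

/-- The rough numbers up to `x` as a `Finset`. -/
def roughUpTo (x y : ℝ) : Finset ℕ := (finite_rough_le x y).toFinset

theorem mem_smoothUpTo {x y : ℝ} {n : ℕ} : n ∈ smoothUpTo x y ↔ n ∈ smoothSet y ∧ (n : ℝ) ≤ x := by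
  simp [smoothUpTo]

theorem mem_roughUpTo {x y : ℝ} {n : ℕ} : n ∈ roughUpTo x y ↔ n ∈ roughSet y ∧ (n : ℝ) ≤ x := by
  simp [roughUpTo]

theorem Psi_eq_card (x y : ℝ) : Psi x y = (smoothUpTo x y).card := by
  rw [Psi, smoothUpTo, ncard_eq_toFinset_card _ (finite_smooth_le x y)]

theorem Phi_eq_card (x y : ℝ) : Phi x y = (roughUpTo x y).card := by
  rw [Phi, roughUpTo, ncard_eq_toFinset_card _ (finite_rough_le x y)]

theorem one_le_of_mem_smoothSet {y : ℝ} {n : ℕ} (hn : n ∈ smoothSet y) : (1 : ℝ) ≤ n := by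
  exact_mod_cast hn.1

theorem exists_smooth_mul_rough (y : ℝ) {m : ℕ} (hm : 1 ≤ m) :
    ∃ a ∈ smoothSet y, ∃ b ∈ roughSet y, a * b = m := by
  have h1s : 1 ∈ smoothSet y := ⟨le_rfl, fun p hp h => absurd (Nat.dvd_one.1 h) hp.one_lt.ne'⟩
  have h1r : 1 ∈ roughSet y := ⟨le_rfl, fun p hp h => absurd (Nat.dvd_one.1 h) hp.one_lt.ne'⟩
  induction m using Nat.recOnMul with
  | zero => omega
  | one => exact ⟨1, h1s, 1, h1r, rfl⟩
  | prime p hp =>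
    rcases le_or_gt (p : ℝ) y with h | h
    · refine ⟨p, ⟨hm, fun q hq hqp => ?_⟩, 1, h1r, mul_one p⟩
      rwa [(Nat.prime_dvd_prime_iff_eq hq hp).1 hqp]
    · refine ⟨1, h1s, p, ⟨hm, fun q hq hqp => ?_⟩, one_mul p⟩
      rwa [(Nat.prime_dvd_prime_iff_eq hq hp).1 hqp]
  | mul m n ihm ihn =>
    obtain ⟨a, ha, b, hb, hab⟩ := ihm (Nat.pos_of_mul_pos_right hm)
    obtain ⟨c, hc, d, hd, hcd⟩ := ihn (Nat.pos_of_mul_pos_left hm)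
    refine ⟨a * c, ⟨Nat.mul_pos ha.1 hc.1, fun p hp h => ?_⟩, b * d,
      ⟨Nat.mul_pos hb.1 hd.1, fun p hp h => ?_⟩, by rw [← hab, ← hcd]; ring⟩
    · exact (hp.dvd_mul.1 h).elim (ha.2 p hp) (hc.2 p hp)
    · exact (hp.dvd_mul.1 h).elim (hb.2 p hp) (hd.2 p hp)

theorem coprime_of_smooth_of_rough {y : ℝ} {a b : ℕ} (ha : a ∈ smoothSet y)
    (hb : b ∈ roughSet y) : Nat.Coprime a b :=
  Nat.coprime_of_dvd fun p hp h1 h2 => absurd (ha.2 p hp h1) (not_le.2 (hb.2 p hp h2))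

theorem smooth_mul_rough_unique {y : ℝ} {a b c d : ℕ} (ha : a ∈ smoothSet y)
    (hb : b ∈ roughSet y) (hc : c ∈ smoothSet y) (hd : d ∈ roughSet y) (h : a * b = c * d) :
    a = c ∧ b = d := by
  have h1 : a ∣ c := (coprime_of_smooth_of_rough ha hd).dvd_of_dvd_mul_right
    (h ▸ dvd_mul_right a b)
  have h2 : c ∣ a := (coprime_of_smooth_of_rough hc hb).dvd_of_dvd_mul_right
    (h ▸ dvd_mul_right c d)
  have hac := Nat.dvd_antisymm h1 h2
  subst hac
  exact ⟨rfl, Nat.eq_of_mul_eq_mul_left ha.1 h⟩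

/-- Every positive integer is uniquely a smooth number times a rough one; sorting the integers up to
`x` by smooth part gives the sum. -/
theorem sum_Phi_eq_floor {x : ℝ} (hx : 0 ≤ x) (y : ℝ) :
    ∑ n ∈ smoothUpTo x y, Phi (x / n) y = ⌊x⌋₊ := by
  have hcard : ((smoothUpTo x y).sigma fun n => roughUpTo (x / n) y).card
      = (Finset.Icc 1 ⌊x⌋₊).card := by
    refine Finset.card_bij (fun z _ => z.1 * z.2) ?_ ?_ ?_
    · rintro ⟨a, b⟩ hz
      simp only [Finset.mem_sigma, mem_smoothUpTo, mem_roughUpTo] at hz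
      obtain ⟨⟨ha, -⟩, hb, hbx⟩ := hz
      have ha1 := one_le_of_mem_smoothSet ha
      rw [Finset.mem_Icc]
      refine ⟨Nat.mul_pos ha.1 hb.1, Nat.le_floor ?_⟩
      rw [le_div_iff₀ (by linarith)] at hbx
      push_cast
      linarith
    · rintro ⟨a, b⟩ hz ⟨c, d⟩ hz' h
      simp only [Finset.mem_sigma, mem_smoothUpTo, mem_roughUpTo] at hz hz'
      obtain ⟨rfl, rfl⟩ := smooth_mul_rough_unique hz.1.1 hz.2.1 hz'.1.1 hz'.2.1 h
      rfl
    · intro m hm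
      rw [Finset.mem_Icc] at hm
      obtain ⟨a, ha, b, hb, rfl⟩ := exists_smooth_mul_rough y hm.1
      have hab : ((a * b : ℕ) : ℝ) ≤ x := (Nat.le_floor_iff hx).1 hm.2
      have ha1 := one_le_of_mem_smoothSet ha
      have hb1 : (1 : ℝ) ≤ b := by exact_mod_cast hb.1
      push_cast at hab
      refine ⟨⟨a, b⟩, ?_, rfl⟩
      simp only [Finset.mem_sigma, mem_smoothUpTo, mem_roughUpTo]
      refine ⟨⟨ha, by nlinarith⟩, hb, ?_⟩
      rw [le_div_iff₀ (by linarith)]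
      linarith
  rw [Finset.card_sigma, Nat.card_Icc, Nat.add_sub_cancel] at hcard
  simp only [Phi_eq_card]
  exact_mod_cast hcard

theorem smoothSet_eq_smoothNumbers {y : ℝ} (hy : 0 ≤ y) :
    smoothSet y = Nat.smoothNumbers (⌊y⌋₊ + 1) := by
  ext n
  rw [Nat.mem_smoothNumbers']
  constructor
  · intro hn p hp hpn
    exact Nat.lt_succ_of_le (Nat.le_floor (hn.2 p hp hpn))
  · intro h
    refine ⟨Nat.one_le_iff_ne_zero.2 fun h0 => ?_, fun p hp hpn =>
      (Nat.le_floor_iff hy).1 (Nat.le_of_lt_succ (h p hp hpn))⟩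
    subst h0
    obtain ⟨p, hp1, hp⟩ := Nat.exists_infinite_primes (⌊y⌋₊ + 1)
    exact absurd (h p hp (dvd_zero p)) (not_lt.2 hp1)

/-- The completely multiplicative function `n ↦ 1 / n`. -/
def invHom : ℕ →* ℝ where
  toFun n := (n : ℝ)⁻¹
  map_one' := by simp
  map_mul' m n := by push_cast; exact mul_inv _ _

/-- The source of the factor `Π(y)⁻¹`: the Euler product of geometric series over `p ≤ y`. -/
theorem hasSum_inv_smoothSet {y : ℝ} (hy : 0 ≤ y) :
    HasSum (fun n : smoothSet y => ((n : ℕ) : ℝ)⁻¹) (PiProd y)⁻¹ := by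
  have h := (EulerProduct.summable_and_hasSum_smoothNumbers_prod_primesBelow_geometric
    (f := invHom) (fun {p} hp => by
      have : (1 : ℝ) < p := by exact_mod_cast hp.one_lt
      simpa [invHom] using inv_lt_one_of_one_lt₀ this) (⌊y⌋₊ + 1)).2
  rw [← smoothSet_eq_smoothNumbers hy] at h
  suffices hP : (PiProd y)⁻¹ = ∏ p ∈ (⌊y⌋₊ + 1).primesBelow, (1 - invHom p)⁻¹ by
    rw [hP]; exact h
  rw [PiProd, ← Finset.prod_inv_distrib]
  refine Finset.prod_congr ?_ fun p _ => by simp [invHom]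
  ext p
  simp only [Finset.mem_filter, Finset.mem_Icc, Nat.mem_primesBelow]
  constructor
  · rintro ⟨⟨-, h⟩, hp⟩; exact ⟨Nat.lt_succ_of_le h, hp⟩
  · rintro ⟨h, hp⟩; exact ⟨⟨hp.one_lt.le, Nat.le_of_lt_succ h⟩, hp⟩

theorem PiProd_pos (y : ℝ) : 0 < PiProd y := by
  refine Finset.prod_pos fun p hp => ?_
  have : (1 : ℝ) < p := by exact_mod_cast (Finset.mem_filter.1 hp).2.one_lt
  have := inv_lt_one_of_one_lt₀ this
  rw [one_div]
  linarith

theorem Psi_mono (y : ℝ) : Monotone fun x => Psi x y := by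
  intro a b hab
  simp only [Psi_eq_card, Nat.cast_le]
  refine Finset.card_le_card fun n hn => ?_
  rw [mem_smoothUpTo] at hn ⊢
  exact ⟨hn.1, hn.2.trans hab⟩

theorem Psi_le (x y : ℝ) (hx : 0 ≤ x) : Psi x y ≤ x := by
  rw [Psi_eq_card]
  have : (smoothUpTo x y).card ≤ (Finset.Icc 1 ⌊x⌋₊).card := by
    refine Finset.card_le_card fun n hn => ?_
    rw [mem_smoothUpTo] at hn
    exact Finset.mem_Icc.2 ⟨hn.1.1, Nat.le_floor hn.2⟩
  rw [Nat.card_Icc, Nat.add_sub_cancel] at this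
  exact (Nat.cast_le.2 this).trans (Nat.floor_le hx)

/-! ### The series for the remainders. -/

theorem Phi_of_lt_one {x : ℝ} (hx : x < 1) (y : ℝ) : Phi x y = 0 := by
  rw [Phi_eq_card, Nat.cast_eq_zero, Finset.card_eq_zero, Finset.eq_empty_iff_forall_notMem]
  intro n hn
  rw [mem_roughUpTo] at hn
  have : (1 : ℝ) ≤ n := by exact_mod_cast hn.1.1
  linarith [hn.2]

theorem Phi_one (y : ℝ) : Phi 1 y = 1 := by
  have : roughUpTo 1 y = {1} := by
    ext n
    rw [mem_roughUpTo, Finset.mem_singleton]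
    constructor
    · rintro ⟨h, h1⟩
      exact le_antisymm (by exact_mod_cast h1) h.1
    · rintro rfl
      exact ⟨⟨le_rfl, fun p hp h => absurd (Nat.dvd_one.1 h) hp.one_lt.ne'⟩, by simp⟩
  rw [Phi_eq_card, this]; simp

theorem muInt_of_nonpos {u : ℝ} (hu : u ≤ 0) (y : ℝ) : muInt y u = 0 := by
  rw [muInt, intervalIntegral.integral_congr (g := fun _ => (0 : ℝ))]
  · simp
  · intro v hv
    rw [uIcc_of_ge hu] at hv
    simp [buchstab_of_lt_one (show u - v < 1 by linarith [hv.1])]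

/-- Consequently the series for `R*` is a finite sum over smooth `n ≤ x`, whereas that for `R` has
an infinite tail. -/
theorem QStar_of_lt_one {x y : ℝ} (hx0 : 0 < x) (hx : x < 1) (hy : 1 < y) : QStar x y = 0 := by
  rw [QStar, VStar, Phi_of_lt_one hx, muInt_of_nonpos, if_neg (not_le.2 hx)]
  · simp
  · exact div_nonpos_of_nonpos_of_nonneg (Real.log_nonpos hx0.le hx.le) (Real.log_pos hy).le

/-- The constant `Π(y) - e^(-γ) / log y`. -/
def mertensGap (y : ℝ) : ℝ := PiProd y - Real.exp (-Real.eulerMascheroniConstant) / Real.log y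

theorem Q_eq (x y : ℝ) : Q x y = QStar x y + x * mertensGap y := by
  rw [Q, V, QStar, VStar, mertensGap]; ring

/-- Hence `Q(1, y)` is exactly `mertensGap y`, so a bound on `Q` at 1 bounds the gap. -/
theorem QStar_one (y : ℝ) : QStar 1 y = 0 := by
  rw [QStar, VStar, Phi_one, muInt_of_nonpos (by simp)]; simp

theorem hasSum_RStar {x y : ℝ} (hx : 0 < x) (hy : 1 < y) :
    HasSum (fun n : smoothSet y => QStar (x / ((n : ℕ) : ℝ)) y)
      (∑ n ∈ smoothUpTo x y, QStar (x / n) y) := by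
  have h : HasSum ((smoothSet y).indicator fun n : ℕ => QStar (x / (n : ℝ)) y)
      (∑ n ∈ smoothUpTo x y, (smoothSet y).indicator (fun n : ℕ => QStar (x / (n : ℝ)) y) n) := by
    refine hasSum_sum_of_ne_finset_zero fun n hn => ?_
    by_cases hs : n ∈ smoothSet y
    · rw [indicator_of_mem hs]
      have h1 := one_le_of_mem_smoothSet hs
      have hlt : x < n := by
        by_contra hc
        exact hn (mem_smoothUpTo.2 ⟨hs, not_lt.1 hc⟩)
      exact QStar_of_lt_one (by positivity) ((div_lt_one (by positivity)).2 hlt) hy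
    · exact indicator_of_notMem hs _
  rw [← hasSum_subtype_iff_indicator] at h
  rw [Finset.sum_congr rfl fun n hn => indicator_of_mem (mem_smoothUpTo.1 hn).1 _] at h
  exact h

theorem hasSum_R {x y : ℝ} (hx : 0 < x) (hy : 1 < y) :
    HasSum (fun n : smoothSet y => Q (x / ((n : ℕ) : ℝ)) y)
      (RStar x y + x * mertensGap y * (PiProd y)⁻¹) := by
  have h := (hasSum_RStar hx hy).summable.hasSum.add
    ((hasSum_inv_smoothSet (y := y) (by linarith)).mul_left (x * mertensGap y))
  have hQ : (fun n : smoothSet y => Q (x / ((n : ℕ) : ℝ)) y) = fun n : smoothSet y =>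
      QStar (x / ((n : ℕ) : ℝ)) y + x * mertensGap y * ((n : ℕ) : ℝ)⁻¹ := by
    funext n
    rw [Q_eq]; ring
  rw [hQ]
  exact h

/-! ### Densities on the logarithmic scale and their convolution equations. -/

/-- The normalized count `Ψ(y^v, y) / y^v`. -/
def smoothDensity (y v : ℝ) : ℝ := Psi (y ^ v) y * y ^ (-v)

/-- The normalized count `⌊y^v⌋ / y^v`. -/
def floorDensity (y v : ℝ) : ℝ := (⌊y ^ v⌋ : ℝ) * y ^ (-v)

theorem measurable_smoothDensity (y : ℝ) : Measurable (smoothDensity y) :=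
  ((Psi_mono y).measurable.comp (measurable_const.pow measurable_id)).mul
    (measurable_const.pow measurable_id.neg)

theorem measurable_floorDensity (y : ℝ) : Measurable (floorDensity y) :=
  (measurable_from_top.comp (Int.measurable_floor.comp (measurable_const.pow measurable_id))).mul
    (measurable_const.pow measurable_id.neg)

theorem abs_smoothDensity_le {y : ℝ} (hy : 0 < y) (v : ℝ) : |smoothDensity y v| ≤ 1 := by
  have h0 := Real.rpow_pos_of_pos hy v
  have h1 := Psi_le (y ^ v) y h0.le
  have h2 : 0 ≤ Psi (y ^ v) y := by rw [Psi_eq_card]; positivity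
  rw [smoothDensity, Real.rpow_neg hy.le, abs_of_nonneg (by positivity), ← div_eq_mul_inv]
  exact div_le_one_of_le₀ h1 h0.le

theorem abs_floorDensity_le {y : ℝ} (hy : 0 < y) (v : ℝ) : |floorDensity y v| ≤ 1 := by
  have h0 := Real.rpow_pos_of_pos hy v
  have h2 : (0 : ℝ) ≤ ⌊y ^ v⌋ := by exact_mod_cast Int.floor_nonneg.2 h0.le
  rw [floorDensity, Real.rpow_neg hy.le, abs_of_nonneg (by positivity), ← div_eq_mul_inv]
  exact div_le_one_of_le₀ (Int.floor_le _) h0.le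

theorem rpow_log_div_log {x y : ℝ} (hx : 0 < x) (hy : 1 < y) :
    y ^ (Real.log x / Real.log y) = x := by
  rw [Real.rpow_def_of_pos (by linarith), mul_div_cancel₀ _ (Real.log_pos hy).ne', Real.exp_log hx]

theorem log_rpow_div_log {y : ℝ} (hy : 1 < y) (v : ℝ) : Real.log (y ^ v) / Real.log y = v := by
  rw [Real.log_rpow (by linarith), mul_div_cancel_right₀ _ (Real.log_pos hy).ne']

theorem intervalIntegrable_buchstab_mul {g : ℝ → ℝ} (hg : Measurable g) {C : ℝ}
    (hC : ∀ v, |g v| ≤ C) (u a b : ℝ) :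
    IntervalIntegrable (fun w => buchstab (u - w) * g w) volume a b := by
  refine intervalIntegrable_of_bounded
    ((measurable_buchstab.comp (measurable_const.sub measurable_id)).mul hg) (C := 1 * C)
    (fun w => ?_) _ _
  rw [Pi.mul_apply, abs_mul]
  exact mul_le_mul (abs_buchstab_le _) (hC _) (abs_nonneg _) zero_le_one

theorem intervalIntegrable_dickmanSlope_mul {g : ℝ → ℝ} (hg : Measurable g) {C : ℝ}
    (hC : ∀ v, |g v| ≤ C) (u a b : ℝ) :
    IntervalIntegrable (fun w => dickmanSlope (u - w) * g w) volume a b := by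
  refine intervalIntegrable_of_bounded
    ((measurable_dickmanSlope.comp (measurable_const.sub measurable_id)).mul hg) (C := 1 * C)
    (fun w => ?_) _ _
  rw [Pi.mul_apply, abs_mul]
  exact mul_le_mul (abs_dickmanSlope_le _) (hC _) (abs_nonneg _) zero_le_one

theorem measurable_truncated_rpow (y c : ℝ) :
    Measurable fun w : ℝ => if c ≤ w then y ^ (-w) else 0 :=
  Measurable.ite measurableSet_Ici (measurable_const.pow measurable_id.neg) measurable_const

theorem abs_truncated_rpow_le {y c : ℝ} (hy : 1 < y) (hc : 0 ≤ c) (w : ℝ) :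
    |if c ≤ w then y ^ (-w) else 0| ≤ 1 := by
  split_ifs with h
  · rw [abs_of_nonneg (Real.rpow_nonneg (by linarith) _)]
    exact Real.rpow_le_one_of_one_le_of_nonpos hy.le (by linarith)
  · simp

/-- Used with `c = log n / log y`: the factor `y^c = n` cancels the `1/n` of `x/n`, and the
substitution `w = v + c` gives all `n` the same kernel `ω(u - w)`, so the sum over `n` can go inside
the integral. -/
theorem muInt_sub {y c u : ℝ} (hy : 1 < y) (hc : 0 ≤ c) (hcu : c ≤ u) :
    muInt y (u - c) = y ^ c *
      ∫ w in (0 : ℝ)..u, buchstab (u - w) * (if c ≤ w then y ^ (-w) else 0) := by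
  have hi := intervalIntegrable_buchstab_mul (measurable_truncated_rpow y c)
    (abs_truncated_rpow_le hy hc) u
  have h0 : ∫ w in (0 : ℝ)..c, buchstab (u - w) * (if c ≤ w then y ^ (-w) else 0) = 0 := by
    rw [intervalIntegral.integral_of_le hc, integral_Ioc_eq_integral_Ioo]
    refine setIntegral_eq_zero_of_forall_eq_zero fun s hs => ?_
    rw [if_neg (not_le.2 hs.2), mul_zero]
  have h1 := intervalIntegral.integral_comp_sub_right (a := c) (b := u)
    (fun v => buchstab (u - c - v) * y ^ (-v)) c
  rw [sub_self] at h1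
  rw [← intervalIntegral.integral_add_adjacent_intervals (hi 0 c) (hi c u), h0, zero_add, muInt,
    ← h1, ← intervalIntegral.integral_const_mul]
  refine intervalIntegral.integral_congr fun s hs => ?_
  rw [uIcc_of_le hcu] at hs
  simp only [if_pos hs.1, show u - c - (s - c) = u - s by ring]
  rw [show -(s - c) = c + -s by ring, Real.rpow_add (by linarith)]
  ring

theorem sum_truncated_rpow {y u w : ℝ} (hy : 1 < y) (hwu : w ≤ u) :
    ∑ n ∈ smoothUpTo (y ^ u) y, (if Real.log n / Real.log y ≤ w then y ^ (-w) else 0)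
      = smoothDensity y w := by
  have hiff : ∀ n ∈ smoothUpTo (y ^ u) y, Real.log n / Real.log y ≤ w ↔ (n : ℝ) ≤ y ^ w := by
    intro n hn
    have h1 := one_le_of_mem_smoothSet (mem_smoothUpTo.1 hn).1
    rw [div_le_iff₀ (Real.log_pos hy), ← Real.log_rpow (by linarith),
      Real.log_le_log_iff (by linarith) (Real.rpow_pos_of_pos (by linarith) _)]
  rw [← Finset.sum_filter, Finset.sum_const, nsmul_eq_mul, smoothDensity, Psi_eq_card]
  congr 3
  ext n
  rw [Finset.mem_filter]
  constructor
  · rintro ⟨hn, h⟩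
    exact mem_smoothUpTo.2 ⟨(mem_smoothUpTo.1 hn).1, (hiff n hn).1 h⟩
  · intro h
    have hn : n ∈ smoothUpTo (y ^ u) y := by
      rw [mem_smoothUpTo] at h ⊢
      exact ⟨h.1, h.2.trans (Real.rpow_le_rpow_of_exponent_le hy.le hwu)⟩
    exact ⟨hn, (hiff n hn).2 (mem_smoothUpTo.1 h).2⟩

/-- Summed over smooth `n ≤ y^u`, the indicators count `Ψ`, the `μ_y` terms assemble into `ω`
convolved with the smooth density, and the `Φ` terms give the floor. -/
theorem RStar_rpow {y u : ℝ} (hy : 1 < y) (hu : 0 ≤ u) :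
    RStar (y ^ u) y = y ^ u * (smoothDensity y u
      + (∫ w in (0 : ℝ)..u, buchstab (u - w) * smoothDensity y w) - floorDensity y u) := by
  have hx : 0 < y ^ u := Real.rpow_pos_of_pos (by linarith) u
  have hterm : ∀ n ∈ smoothUpTo (y ^ u) y, QStar (y ^ u / n) y = 1
      + y ^ u * (∫ w in (0 : ℝ)..u, buchstab (u - w) *
          (if Real.log n / Real.log y ≤ w then y ^ (-w) else 0)) - Phi (y ^ u / n) y := by
    intro n hn
    obtain ⟨hn, hnx⟩ := mem_smoothUpTo.1 hn
    have h1 := one_le_of_mem_smoothSet hn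
    have hn0 : (0 : ℝ) < n := by linarith
    have hc : Real.log n / Real.log y ≤ u := by
      rw [div_le_iff₀ (Real.log_pos hy), ← Real.log_rpow (by linarith)]
      exact Real.log_le_log hn0 hnx
    rw [QStar, VStar, if_pos ((one_le_div hn0).2 hnx), Real.log_div hx.ne' hn0.ne', sub_div,
      log_rpow_div_log hy, muInt_sub hy (div_nonneg (Real.log_nonneg h1) (Real.log_pos hy).le) hc,
      rpow_log_div_log hn0 hy]
    field_simp
  rw [RStar, (hasSum_RStar hx hy).tsum_eq, Finset.sum_congr rfl hterm, Finset.sum_sub_distrib,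
    Finset.sum_add_distrib, sum_Phi_eq_floor hx.le, ← Finset.mul_sum,
    ← intervalIntegral.integral_finsetSum fun n hn => intervalIntegrable_buchstab_mul
      (measurable_truncated_rpow y _) (abs_truncated_rpow_le hy (div_nonneg (Real.log_nonneg
        (one_le_of_mem_smoothSet (mem_smoothUpTo.1 hn).1)) (Real.log_pos hy).le)) _ _ _]
  have hint : (∫ w in (0 : ℝ)..u, ∑ n ∈ smoothUpTo (y ^ u) y, buchstab (u - w) *
      (if Real.log n / Real.log y ≤ w then y ^ (-w) else 0))
      = ∫ w in (0 : ℝ)..u, buchstab (u - w) * smoothDensity y w := by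
    refine intervalIntegral.integral_congr fun w hw => ?_
    rw [uIcc_of_le hu] at hw
    simp only [← Finset.mul_sum, sum_truncated_rpow hy hw.2]
  rw [hint, smoothDensity, floorDensity, Psi_eq_card, Real.rpow_neg (by linarith),
    natCast_floor_eq_intCast_floor hx.le]
  simp only [Finset.sum_const, nsmul_eq_mul, mul_one]
  field_simp

/-- With `{y^v} / y^v = 1 - N(v)`, where `N` is `floorDensity y`, the constant 1 integrates against
`ρ'` to `ρ(u) - 1`, which cancels the main term `x ρ(u)` and leaves `x - {x} = ⌊x⌋`. -/
theorem Lambda_rpow {y u : ℝ} (hy : 1 < y) (hu : 0 ≤ u) :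
    Lambda (y ^ u) y = y ^ u * (floorDensity y u
      + ∫ v in (0 : ℝ)..u, dickmanSlope (u - v) * floorDensity y v) := by
  have hpos : ∀ v : ℝ, 0 < y ^ v := Real.rpow_pos_of_pos (by linarith)
  -- At these two points `ρ'` is taken at 0 or 1, where its one-sided value is immaterial to the
  -- integral.
  have hae : ∀ᵐ v : ℝ, v ∉ ({u, u - 1} : Set ℝ) :=
    ((countable_singleton (u - 1)).insert u).ae_notMem _
  have h1 : (∫ v in (0 : ℝ)..u, dickmanDeriv (u - v) * (Int.fract (y ^ v) / y ^ v))
      = ∫ v in (0 : ℝ)..u,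
        (dickmanSlope (u - v) - dickmanSlope (u - v) * floorDensity y v) := by
    refine intervalIntegral.integral_congr_ae ?_
    filter_upwards [hae] with v hv hvu
    rw [uIoc_of_le hu] at hvu
    have hvu' : v < u := lt_of_le_of_ne hvu.2 fun h => hv (by simp [h])
    have hv1 : u - v ≠ 1 := fun h => hv (by right; rw [mem_singleton_iff]; linarith)
    have := (hpos v).ne'
    rw [dickmanDeriv_eq (by linarith) hv1, floorDensity, Real.rpow_neg (by linarith), Int.fract]
    field_simp
  have h2 : (∫ v in (0 : ℝ)..u, dickmanSlope (u - v)) = dickman u - 1 := by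
    rw [intervalIntegral.integral_comp_sub_left dickmanSlope u, sub_self, sub_zero,
      integral_dickmanSlope hu]
  have hD : IntervalIntegrable (fun v => dickmanSlope (u - v)) volume 0 u :=
    intervalIntegrable_of_bounded (measurable_dickmanSlope.comp
      (measurable_const.sub measurable_id)) (fun _ => abs_dickmanSlope_le _) _ _
  rw [Lambda, log_rpow_div_log hy, h1, intervalIntegral.integral_sub hD
    (intervalIntegrable_dickmanSlope_mul (measurable_floorDensity y)
      (abs_floorDensity_le (by linarith)) _ _ _), h2]
  have : y ^ u * floorDensity y u = y ^ u - Int.fract (y ^ u) := by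
    have := (hpos u).ne'
    rw [floorDensity, Real.rpow_neg (by linarith), Int.fract]
    field_simp
    ring
  rw [mul_add, this]
  ring

/-- The normalized remainder `R*(y^v, y) / y^v`. -/
def remainderDensity (y v : ℝ) : ℝ := RStar (y ^ v) y * y ^ (-v)

theorem remainderDensity_eq {y v : ℝ} (hy : 1 < y) (hv : 0 ≤ v) :
    remainderDensity y v = smoothDensity y v
      + (∫ w in (0 : ℝ)..v, buchstab (v - w) * smoothDensity y w) - floorDensity y v := by
  have := (Real.rpow_pos_of_pos (show 0 < y by linarith) v).ne'
  rw [remainderDensity, RStar_rpow hy hv, Real.rpow_neg (by linarith)]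
  field_simp

/-- Inversion: `Δ(x) / x` is the convolution of `dρ` with `R*(x) / x`. -/
theorem Delta_rpow {y u : ℝ} (hy : 1 < y) (hu : 0 ≤ u) :
    IntervalIntegrable (fun v => dickmanSlope (u - v) * remainderDensity y v) volume 0 u ∧
    Delta (y ^ u) y = y ^ u * (remainderDensity y u
      + ∫ v in (0 : ℝ)..u, dickmanSlope (u - v) * remainderDensity y v) := by
  have hy0 : 0 < y := by linarith
  obtain ⟨hI, heq⟩ := integral_dickmanSlope_mul_integral_buchstab (measurable_smoothDensity y)
    (abs_smoothDensity_le hy0) hu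
  have hS := intervalIntegrable_dickmanSlope_mul (measurable_smoothDensity y)
    (abs_smoothDensity_le hy0) u 0 u
  have hN := intervalIntegrable_dickmanSlope_mul (measurable_floorDensity y)
    (abs_floorDensity_le hy0) u 0 u
  have hcongr : EqOn (fun v => dickmanSlope (u - v) * remainderDensity y v)
      (fun v => dickmanSlope (u - v) * smoothDensity y v
        + dickmanSlope (u - v) * (∫ w in (0 : ℝ)..v, buchstab (v - w) * smoothDensity y w)
        - dickmanSlope (u - v) * floorDensity y v) (uIcc 0 u) := by
    intro v hv
    rw [uIcc_of_le hu] at hv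
    simp only [remainderDensity_eq hy hv.1]
    ring
  refine ⟨((hS.add hI).sub hN).congr fun v hv => (hcongr (uIoc_subset_uIcc hv)).symm, ?_⟩
  -- By `heq`, `ρ' * (ω * S) = -(ρ' * S + ω * S)`, so every convolution of the smooth density `S`
  -- cancels and `S - (N + ρ' * N)` remains.
  rw [intervalIntegral.integral_congr hcongr, intervalIntegral.integral_sub (hS.add hI) hN,
    intervalIntegral.integral_add hS hI, heq, remainderDensity_eq hy hu, Delta, Lambda_rpow hy hu]
  have : Psi (y ^ u) y = y ^ u * smoothDensity y u := by
    have := (Real.rpow_pos_of_pos hy0 u).ne'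
    rw [smoothDensity, Real.rpow_neg hy0.le]
    field_simp
  rw [this]
  ring

/-! ### From bounds on the remainder to the bound on `Δ`. -/

/-- The shift `c` lets one statement cover both `R` and `R*`. With `r = remainderDensity y` and `h =
r + c`, inversion reads `Δ/x = h(u) + (ρ' * h)(u) - c ρ(u)`. The three terms are at most `F`, `(1 -
ρ(u)) F` and `ρ(u) F`, in total `2F`. -/
theorem abs_Delta_le {x y c F : ℝ} (hy : 1 < y) (hx : 1 ≤ x) (hc : |c| ≤ F)
    (hR : ∀ t, 1 ≤ t → t ≤ x → |RStar t y + t * c| ≤ t * F) : |Delta x y| ≤ 2 * x * F := by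
  have hy0 : 0 < y := by linarith
  obtain ⟨u, hu, rfl⟩ : ∃ u, 0 ≤ u ∧ y ^ u = x :=
    ⟨_, div_nonneg (Real.log_nonneg hx) (Real.log_pos hy).le, rpow_log_div_log (by linarith) hy⟩
  obtain ⟨hI, hΔ⟩ := Delta_rpow hy hu
  have hh : ∀ v, 0 ≤ v → v ≤ u → |remainderDensity y v + c| ≤ F := by
    intro v h0 h1
    have hv := Real.rpow_pos_of_pos hy0 v
    have h2 := hR (y ^ v) (Real.one_le_rpow hy.le h0) (Real.rpow_le_rpow_of_exponent_le hy.le h1)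
    have h3 : RStar (y ^ v) y + y ^ v * c = y ^ v * (remainderDensity y v + c) := by
      rw [remainderDensity, Real.rpow_neg hy0.le]
      field_simp
    rw [h3, abs_mul, abs_of_pos hv] at h2
    exact le_of_mul_le_mul_left h2 hv
  have hD : IntervalIntegrable (fun v => dickmanSlope (u - v)) volume 0 u :=
    intervalIntegrable_of_bounded (measurable_dickmanSlope.comp
      (measurable_const.sub measurable_id)) (fun _ => abs_dickmanSlope_le _) _ _
  have hint : (∫ v in (0 : ℝ)..u, dickmanSlope (u - v)) = dickman u - 1 := by
    rw [intervalIntegral.integral_comp_sub_left dickmanSlope u, sub_self, sub_zero,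
      integral_dickmanSlope hu]
  have hsplit : (∫ v in (0 : ℝ)..u, dickmanSlope (u - v) * (remainderDensity y v + c))
      = (∫ v in (0 : ℝ)..u, dickmanSlope (u - v) * remainderDensity y v)
        + (dickman u - 1) * c := by
    simp only [mul_add]
    rw [intervalIntegral.integral_add hI (hD.mul_const c), intervalIntegral.integral_mul_const,
      hint]
  have hbound : |∫ v in (0 : ℝ)..u, dickmanSlope (u - v) * (remainderDensity y v + c)|
      ≤ (1 - dickman u) * F := by
    have h1 : (∫ v in (0 : ℝ)..u, -dickmanSlope (u - v) * F) = (1 - dickman u) * F := by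
      rw [intervalIntegral.integral_mul_const, intervalIntegral.integral_neg, hint]; ring
    rw [← h1, ← Real.norm_eq_abs]
    refine intervalIntegral.norm_integral_le_of_norm_le hu (ae_of_all _ fun v hv => ?_)
      (hD.neg.mul_const F)
    rw [Real.norm_eq_abs, abs_mul, abs_of_nonpos (dickmanSlope_nonpos _)]
    exact mul_le_mul_of_nonneg_left (hh v hv.1.le hv.2)
      (neg_nonneg.2 (dickmanSlope_nonpos _))
  have hcρ : |c * dickman u| ≤ F * dickman u := by
    rw [abs_mul, abs_of_nonneg (dickman_nonneg u)]
    exact mul_le_mul_of_nonneg_right hc (dickman_nonneg u)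
  have hu' := hh u hu le_rfl
  have hx0 := Real.rpow_pos_of_pos hy0 u
  rw [hΔ, abs_mul, abs_of_pos hx0, mul_comm 2, mul_assoc]
  refine mul_le_mul_of_nonneg_left ?_ hx0.le
  rw [abs_le] at hbound hcρ hu' ⊢
  constructor <;> linarith [hbound.1, hbound.2, hcρ.1, hcρ.2, hu'.1, hu'.2]

theorem summable_and_abs_tsum_le {y x C : ℝ} (hy : 0 ≤ y) (hx : 0 < x) {g : ℝ → ℝ}
    (hg : ∀ t, 0 < t → t ≤ x → |g t| ≤ t * C) :
    Summable (fun n : smoothSet y => g (x / ((n : ℕ) : ℝ))) ∧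
      |∑' n : smoothSet y, g (x / ((n : ℕ) : ℝ))| ≤ x * C * (PiProd y)⁻¹ := by
  have hs := (hasSum_inv_smoothSet hy).mul_left (x * C)
  have hb : ∀ n : smoothSet y, ‖g (x / ((n : ℕ) : ℝ))‖ ≤ x * C * ((n : ℕ) : ℝ)⁻¹ := by
    intro n
    have h1 := one_le_of_mem_smoothSet n.2
    rw [Real.norm_eq_abs]
    refine (hg _ (by positivity) (div_le_self hx.le h1)).trans_eq ?_
    rw [div_eq_mul_inv]; ring
  exact ⟨Summable.of_norm_bounded hs.summable hb, tsum_of_norm_bounded hs hb⟩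

theorem Q_of_lt_one {x y : ℝ} (hx0 : 0 < x) (hx : x < 1) (hy : 1 < y) :
    Q x y = x * mertensGap y := by
  rw [Q_eq, QStar_of_lt_one hx0 hx hy, zero_add]

end SmoothRough

end

/-! ### The corollary. -/

theorem corollary1 (X y : ℝ) (f : ℝ → ℝ) (hX : 1 ≤ X) (hy : 2 ≤ y) (hf : 0 < f y) :
    ((∀ x : ℝ, 1 ≤ x → x ≤ X → |SmoothRough.Q x y| ≤ x * f y) →
      (∀ x : ℝ, 0 < x → x ≤ X →
        Summable (fun n : SmoothRough.smoothSet y => SmoothRough.Q (x / ((n : ℕ) : ℝ)) y) ∧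
        |SmoothRough.R x y| ≤ x * f y * (SmoothRough.PiProd y)⁻¹) ∧
      (∀ x : ℝ, 1 ≤ x → x ≤ X →
        |SmoothRough.Delta x y| ≤ 2 * x * f y * (SmoothRough.PiProd y)⁻¹)) ∧
    ((∀ x : ℝ, 1 ≤ x → x ≤ X → |SmoothRough.QStar x y| ≤ x * f y) →
      (∀ x : ℝ, 0 < x → x ≤ X →
        Summable (fun n : SmoothRough.smoothSet y => SmoothRough.QStar (x / ((n : ℕ) : ℝ)) y) ∧
        |SmoothRough.RStar x y| ≤ x * f y * (SmoothRough.PiProd y)⁻¹) ∧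
      (∀ x : ℝ, 1 ≤ x → x ≤ X →
        |SmoothRough.Delta x y| ≤ 2 * x * f y * (SmoothRough.PiProd y)⁻¹)) := by
  have hy1 : 1 < y := by linarith
  have hy0 : 0 ≤ y := by linarith
  have hpi := inv_pos.2 (SmoothRough.PiProd_pos y)
  refine ⟨fun h => ?_, fun h => ?_⟩
  · have hgap : |SmoothRough.mertensGap y| ≤ f y := by
      simpa [SmoothRough.Q_eq, SmoothRough.QStar_one] using h 1 le_rfl hX
    -- The tail `n > x` of the series needs the bound below 1 too; there `Q(t, y)` is `t` times the
    -- gap.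
    have hQ : ∀ t, 0 < t → t ≤ X → |SmoothRough.Q t y| ≤ t * f y := by
      intro t ht htX
      rcases lt_or_ge t 1 with h1 | h1
      · rw [SmoothRough.Q_of_lt_one ht h1 hy1, abs_mul, abs_of_pos ht]
        exact mul_le_mul_of_nonneg_left hgap ht.le
      · exact h t h1 htX
    have hR : ∀ x : ℝ, 0 < x → x ≤ X →
        Summable (fun n : SmoothRough.smoothSet y => SmoothRough.Q (x / ((n : ℕ) : ℝ)) y) ∧
        |SmoothRough.R x y| ≤ x * f y * (SmoothRough.PiProd y)⁻¹ := fun x hx hxX =>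
      SmoothRough.summable_and_abs_tsum_le (g := fun t => SmoothRough.Q t y) hy0 hx
        fun t ht htx => hQ t ht (htx.trans hxX)
    refine ⟨hR, fun x hx hxX => ?_⟩
    rw [mul_assoc _ (f y)]
    -- By `hasSum_R`, `R(t, y) = R*(t, y) + t c` for this `c`.
    refine SmoothRough.abs_Delta_le (c := SmoothRough.mertensGap y * (SmoothRough.PiProd y)⁻¹)
      hy1 hx ?_ fun t ht htx => ?_
    · rw [abs_mul, abs_of_pos hpi]
      exact mul_le_mul_of_nonneg_right hgap hpi.le
    · have ht0 : 0 < t := by linarith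
      have hsum := (SmoothRough.hasSum_R ht0 hy1).tsum_eq
      rw [← mul_assoc, ← mul_assoc, ← hsum]
      exact (hR t ht0 (htx.trans hxX)).2
  · have hQ : ∀ t, 0 < t → t ≤ X → |SmoothRough.QStar t y| ≤ t * f y := by
      intro t ht htX
      rcases lt_or_ge t 1 with h1 | h1
      · rw [SmoothRough.QStar_of_lt_one ht h1 hy1, abs_zero]
        positivity
      · exact h t h1 htX
    have hR : ∀ x : ℝ, 0 < x → x ≤ X →
        Summable (fun n : SmoothRough.smoothSet y => SmoothRough.QStar (x / ((n : ℕ) : ℝ)) y) ∧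
        |SmoothRough.RStar x y| ≤ x * f y * (SmoothRough.PiProd y)⁻¹ := fun x hx hxX =>
      SmoothRough.summable_and_abs_tsum_le (g := fun t => SmoothRough.QStar t y) hy0 hx
        fun t ht htx => hQ t ht (htx.trans hxX)
    refine ⟨hR, fun x hx hxX => ?_⟩
    rw [mul_assoc _ (f y)]
    refine SmoothRough.abs_Delta_le (c := 0) hy1 hx ?_ fun t ht htx => ?_
    · rw [abs_zero]; positivity
    · rw [mul_zero, add_zero, ← mul_assoc]
      exact (hR t (by linarith) (htx.trans hxX)).2
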